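/- Let $G$ be a locally compact, Hausdorff, second countable topological groupoid with unit space $G^0$, source and range maps $s,r$, where $xy$ is defined if and only if $s(x)=r(y)$, and let $G^u=r^{-1}(u)$. Let $\{\lambda^u\}_{u\in G^0}$ be a left Haar system on $G$: each $\lambda^u$ is a positive regular Borel measure on $G^u$ with full support, $u\mapsto\int f\,d\lambda^u$ is continuous for every $f\in C_c(G)$, and $\int f(xz)\,d\lambda^{s(x)}(z)=\int f(y)\,d\lambda^{r(x)}(y)$ for all $x\in G$, $f\in C_c(G)$. A bounded continuous function $\varphi:G\to\mathbb{C}$ is called positive definite if for all $u\in G^0$ and all $f\in C_c(G)$ $$\iint \varphi(y^{-1}x)f(y)\overline{f(x)}\,d\lambda^u(x)\,d\lambda^u(y)\ge 0 .$$ A continuous $G$-Hilbert bundle is a continuous field (in the sense of Dixmier) of separable complex Hilbert spaces $\{H^u\}_{u\in G^0}$ over $G^0$ together with linear isometries $L_x$ of $H^{s(x)}$ onto $H^{r(x)}$ $(x\in G)$ such that $L_{xy}=L_xL_y$ whenever $s(x)=r(y)$, $L_u=\mathrm{id}$ for $u\in G^0$, and, for all bounded continuous sections $\xi,\eta$, the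 function $(\xi,\eta):x\mapsto (L_x\xi(s(x)),\eta(r(x)))$ is continuous on $G$ (inner products are conjugate linear in the first variable). Theorem. Let $\varphi:G\to\mathbb{C}$ be bounded and continuous. Then $\varphi$ is positive definite if and only if there are a continuous $G$-Hilbert bundle and a bounded continuous section $\xi$ of it such that $\varphi=(\xi,\xi)$, that is, $\varphi(x)=(L_x\xi(s(x)),\xi(r(x)))$ for all $x\in G$. -/

import Mathlib

open MeasureTheory Topology CategoryTheory
open scoped ComplexOrder ComplexConjugate BoundedContinuousFunction CompactlySupported

universe u v w

/-!
  A groupoid is given by its unit space `X` (the type of objects) and its space of arrows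
  `Quiver.Total X`. An arrow `x : a ⟶ b` has source `s(x) = a` and range `r(x) = b`, so that the
  product `xy`, which is defined if and only if `s(x) = r(y)`, is `y ≫ x`, and a unit `u` is
  identified with the arrow `𝟙 u`.
-/

namespace PatersonGroupoid

section Groupoid

variable (X : Type u) [Groupoid.{v} X]

/-- A pair of composable arrows. -/
structure ComposablePair where
  {a b c : X}
  fst : a ⟶ b
  snd : b ⟶ c

/-- The space of composable pairs as a subspace of the product of two copies of the arrow space. -/
instance instTopologicalSpaceComposablePair [TopologicalSpace (Quiver.Total X)] :
    TopologicalSpace (ComposablePair X) :=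
  TopologicalSpace.induced
    (fun p => ((⟨p.a, p.b, p.fst⟩, ⟨p.b, p.c, p.snd⟩) : Quiver.Total X × Quiver.Total X))
    inferInstance

/-- A topological groupoid: all the structure maps are continuous. As the unit map has the
continuous left inverse `s`, the topology of `X` is the one that `X` has as a subspace of the
space of arrows. -/
class IsTopologicalGroupoid [TopologicalSpace X] [TopologicalSpace (Quiver.Total X)] :
    Prop where
  continuous_source : Continuous (fun x : Quiver.Total X => x.left)
  continuous_range : Continuous (fun x : Quiver.Total X => x.right)
  continuous_unit : Continuous (fun a : X => (⟨a, a, 𝟙 a⟩ : Quiver.Total X))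
  continuous_inv :
    Continuous (fun x : Quiver.Total X => (⟨x.right, x.left, Groupoid.inv x.hom⟩ : Quiver.Total X))
  continuous_mul :
    Continuous (fun p : ComposablePair X => (⟨p.a, p.c, p.fst ≫ p.snd⟩ : Quiver.Total X))

variable {X}

/-- The fibre `G^a` of the range map: the arrows with range `a`. -/
structure RFiber (a : X) where
  {source : X}
  hom : source ⟶ a

/-- An element of the fibre `G^a` as an arrow. -/
def RFiber.toTotal {a : X} (x : RFiber a) : Quiver.Total X := ⟨x.source, a, x.hom⟩

/-- The fibre `G^a` is a subspace of the space of arrows. -/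
instance instTopologicalSpaceRFiber (a : X) [TopologicalSpace (Quiver.Total X)] :
    TopologicalSpace (RFiber a) :=
  TopologicalSpace.induced RFiber.toTotal inferInstance

instance instMeasurableSpaceRFiber (a : X) [TopologicalSpace (Quiver.Total X)] :
    MeasurableSpace (RFiber a) :=
  borel (RFiber a)

/-- Left translation by the arrow `g`, that is `x ↦ g x`, from `G^{s(g)}` to `G^{r(g)}`. -/
def RFiber.translate {a b : X} (g : a ⟶ b) (x : RFiber a) : RFiber b := ⟨x.hom ≫ g⟩

/-- The arrow `y⁻¹ x`, for `x` and `y` with the same range. -/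
def RFiber.invMul {a : X} (y x : RFiber a) : Quiver.Total X :=
  ⟨x.source, y.source, x.hom ≫ Groupoid.inv y.hom⟩

variable (X)

/-- A left Haar system: positive regular Borel measures on the fibres `G^a` with full support,
varying continuously with `a` and invariant under left translation. -/
structure LeftHaarSystem [TopologicalSpace X] [TopologicalSpace (Quiver.Total X)] where
  measure : ∀ a : X, Measure (RFiber a)
  regular : ∀ a, (measure a).Regular
  full_support : ∀ a, (measure a).IsOpenPosMeasure
  continuous_integral : ∀ f : C_c(Quiver.Total X, ℂ),
    Continuous (fun a : X => ∫ x : RFiber a, f x.toTotal ∂(measure a))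
  left_invariant : ∀ {a b : X} (g : a ⟶ b) (f : C_c(Quiver.Total X, ℂ)),
    ∫ x : RFiber a, f (x.translate g).toTotal ∂(measure a)
      = ∫ y : RFiber b, f y.toTotal ∂(measure b)

variable {X}

/-- Positive definiteness of `φ ∈ C(G)`:
`∬ φ(y⁻¹x) f(y) conj(f(x)) dλ^a(x) dλ^a(y) ≥ 0` for all units `a` and all `f ∈ C_c(G)`.
The order on `ℂ` is the one in which `0 ≤ z` says that `z` is real and nonnegative. -/
def IsPositiveDefinite [TopologicalSpace X] [TopologicalSpace (Quiver.Total X)]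
    (haar : LeftHaarSystem X) (φ : Quiver.Total X →ᵇ ℂ) : Prop :=
  ∀ (a : X) (f : C_c(Quiver.Total X, ℂ)),
    0 ≤ ∫ y : RFiber a, ∫ x : RFiber a,
      φ (y.invMul x) * f y.toTotal * conj (f x.toTotal) ∂(haar.measure a) ∂(haar.measure a)

end Groupoid

/-- A continuous Hilbert bundle over `X`: a continuous field of (separable) Hilbert spaces in the
sense of Dixmier, with its space `sections` of continuous sections. -/
structure ContinuousHilbertBundle (X : Type u) [TopologicalSpace X] where
  fiber : X → Type w
  [normedAddCommGroup : ∀ a, NormedAddCommGroup (fiber a)]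
  [innerProductSpace : ∀ a, InnerProductSpace ℂ (fiber a)]
  [completeSpace : ∀ a, CompleteSpace (fiber a)]
  [separableSpace : ∀ a, TopologicalSpace.SeparableSpace (fiber a)]
  sections : Submodule ℂ (∀ a, fiber a)
  dense_eval : ∀ a, Dense {z : fiber a | ∃ ξ ∈ sections, ξ a = z}
  continuous_norm : ∀ ξ ∈ sections, Continuous (fun a => ‖ξ a‖)
  mem_of_locally_approx : ∀ ξ : ∀ a, fiber a,
    (∀ a, ∀ ε > (0 : ℝ), ∃ η ∈ sections, ∀ᶠ b in 𝓝 a, ‖ξ b - η b‖ ≤ ε) → ξ ∈ sections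

attribute [instance] ContinuousHilbertBundle.normedAddCommGroup
  ContinuousHilbertBundle.innerProductSpace ContinuousHilbertBundle.completeSpace
  ContinuousHilbertBundle.separableSpace

/-- The space `Δ_b` of bounded continuous sections. -/
def ContinuousHilbertBundle.boundedSections {X : Type u} [TopologicalSpace X]
    (H : ContinuousHilbertBundle.{u, w} X) : Set (∀ a, H.fiber a) :=
  {ξ | ξ ∈ H.sections ∧ ∃ C : ℝ, ∀ a, ‖ξ a‖ ≤ C}

/-- A `G`-Hilbert bundle: a continuous Hilbert bundle over the unit space on which the arrows act
by linear isometries `L x` of the fibre at `s(x)` onto the fibre at `r(x)`, functorially, and such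
that the coefficients of bounded continuous sections are continuous. -/
structure GHilbertBundle (X : Type u) [Groupoid.{v} X] [TopologicalSpace X]
    [TopologicalSpace (Quiver.Total X)] extends ContinuousHilbertBundle.{u, w} X where
  L : ∀ {a b : X}, (a ⟶ b) → (fiber a ≃ₗᵢ[ℂ] fiber b)
  L_id : ∀ (a : X) (z : fiber a), L (𝟙 a) z = z
  L_comp : ∀ {a b c : X} (y : a ⟶ b) (x : b ⟶ c) (z : fiber a), L (y ≫ x) z = L x (L y z)
  continuous_coefficient : ∀ ξ ∈ toContinuousHilbertBundle.boundedSections,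
    ∀ η ∈ toContinuousHilbertBundle.boundedSections,
      Continuous (fun x : Quiver.Total X => inner ℂ (L x.hom (ξ x.left)) (η x.right))

/-- The coefficient `(ξ, η)`, that is the function `x ↦ (L_x ξ(s(x)), η(r(x)))` on `G`; inner
products are conjugate linear in the first variable. -/
noncomputable def GHilbertBundle.coefficient {X : Type u} [Groupoid.{v} X] [TopologicalSpace X]
    [TopologicalSpace (Quiver.Total X)] (H : GHilbertBundle.{u, v, w} X)
    (ξ η : ∀ a, H.fiber a) (x : Quiver.Total X) : ℂ :=
  inner ℂ (H.L x.hom (ξ x.left)) (η x.right)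

end PatersonGroupoid

/-! If φ = (ξ, ξ), put v_x = L_x ξ(s(x)) for x in G^u. Since the L_x are unitary, φ(y⁻¹x) = (v_x,
v_y), so the double integral in the definition of positive definiteness is the squared norm of ∫
f(x) v_x dλ^u(x).

Conversely, testing positive definiteness on combinations of bump functions, which the full support
of λ^u allows to be normalized, shows that (x, y) ↦ φ(y⁻¹x) is a positive definite kernel on each
G^u (`IsPositiveDefinite.sum_nonneg`). Moore's theorem (`exists_inner_eq_kernel`) gives a Hilbert
space H^u spanned by vectors v_x with (v_x, v_y) = φ(y⁻¹x). The kernel is invariant under left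
translation, so v_x ↦ v_{gx} extends to a unitary L_g. With ξ(u) = v_u, (L_x ξ(s(x)), ξ(r(x))) =
(v_x, v_{r(x)}) = φ(x).

The continuous field is generated by the sections u ↦ ∫ f(x) v_x dλ^u(x), f in C_c(G). Their
coefficients are iterated fibre integrals, continuous by `continuous_integral_param`. Finally, ξ is
a continuous section: ‖v_x - v_{r(x)}‖² = Re φ(s(x)) - 2 Re φ(x) + Re φ(r(x)) is continuous on G and
vanishes at units, so averages of v_x over bumps near a unit approximate ξ locally uniformly. -/

namespace PatersonGroupoid

/-! ### Hilbert spaces from positive definite kernels -/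

section FeatureMap

/-- A map into an inner product space is continuous if its Gram kernel is. -/
theorem continuous_of_continuous_inner {S E : Type*} [TopologicalSpace S] [NormedAddCommGroup E]
    [InnerProductSpace ℂ E] {k : S → E}
    (h : Continuous fun p : S × S => inner ℂ (k p.1) (k p.2)) : Continuous k := by
  rw [continuous_iff_continuousAt]
  intro x
  rw [ContinuousAt, tendsto_iff_norm_sub_tendsto_zero]
  have h1 : Continuous fun y => ‖k y - k x‖ ^ 2 := by
    have h2 : Continuous fun y => Complex.re (inner ℂ (k y) (k y)) :=
      Complex.continuous_re.comp (h.comp (by fun_prop : Continuous fun y : S => (y, y)))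
    have h3 : Continuous fun y => Complex.re (inner ℂ (k y) (k x)) :=
      Complex.continuous_re.comp (h.comp (by fun_prop : Continuous fun y : S => (y, x)))
    have h4 : ∀ y, ‖k y - k x‖ ^ 2 = Complex.re (inner ℂ (k y) (k y))
        - 2 * Complex.re (inner ℂ (k y) (k x)) + ‖k x‖ ^ 2 := by
      intro y
      have := norm_sub_sq (𝕜 := ℂ) (k y) (k x)
      have h5 := inner_self_eq_norm_sq (𝕜 := ℂ) (k y)
      simp only [RCLike.re_to_complex] at this h5
      rw [this, h5]
    simp only [h4]
    fun_prop
  have h2 : Filter.Tendsto (fun y => Real.sqrt (‖k y - k x‖ ^ 2)) (𝓝 x) (𝓝 0) := by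
    have := (Real.continuous_sqrt.comp h1).tendsto x
    simpa only [Function.comp_def, sub_self, norm_zero, ne_eq, OfNat.ofNat_ne_zero,
      not_false_eq_true, zero_pow, Real.sqrt_zero] using this
  simpa using h2

/-- A kernel all of whose quadratic forms are nonnegative is Hermitian. -/
theorem conj_eq_of_forall_sum_nonneg {S : Type*} {K : S → S → ℂ}
    (pos : ∀ (n : ℕ) (x : Fin n → S) (c : Fin n → ℂ),
      0 ≤ ∑ i, ∑ j, conj (c i) * c j * K (x i) (x j)) (x y : S) : conj (K y x) = K x y := by
  have hx := pos 1 ![x] ![1]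
  have hy := pos 1 ![y] ![1]
  -- The diagonal entries are real, so these weights make K x y + K y x and i(K x y - K y x) real.
  have h1 := pos 2 ![x, y] ![1, 1]
  have h2 := pos 2 ![x, y] ![1, Complex.I]
  simp [Fin.sum_univ_two, Complex.le_def] at hx hy h1 h2
  apply Complex.ext
  · simp; linarith [h2.2, hx.2, hy.2]
  · simp; linarith [h1.2, hx.2, hy.2]

/-- An orthonormal family in a separable inner product space is countable. -/
theorem countable_of_orthonormal {ι E : Type*} [NormedAddCommGroup E] [InnerProductSpace ℂ E]
    [TopologicalSpace.SeparableSpace E] {b : ι → E} (hb : Orthonormal ℂ b) : Countable ι := by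
  rw [← Set.countable_univ_iff]
  refine Set.PairwiseDisjoint.countable_of_isOpen (s := fun i => Metric.ball (b i) (1 / 2)) ?_
    (fun _ _ => Metric.isOpen_ball) (fun i _ => ⟨b i, by simp⟩)
  intro i _ j _ hij
  refine Metric.ball_disjoint_ball ?_
  -- Distinct members are √2 > 1/2 + 1/2 apart, so the balls are disjoint.
  have h : ‖b i - b j‖ ^ 2 = 2 := by
    have := norm_sub_sq (𝕜 := ℂ) (b i) (b j)
    rw [this, hb.2 hij, hb.1 i, hb.1 j]
    norm_num
  rw [dist_eq_norm]
  nlinarith [norm_nonneg (b i - b j)]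

/-- A separable Hilbert space embeds isometrically into `ℓ²`, in any universe. -/
theorem exists_linearIsometry_lp (E : Type*) [NormedAddCommGroup E] [InnerProductSpace ℂ E]
    [CompleteSpace E] [TopologicalSpace.SeparableSpace E] :
    Nonempty (E →ₗᵢ[ℂ] lp (fun _ : ULift.{w} ℕ => ℂ) 2) := by
  classical
  obtain ⟨s, b, -⟩ := exists_hilbertBasis ℂ E
  have : Countable s := countable_of_orthonormal b.orthonormal
  obtain ⟨e, he⟩ := exists_injective_nat s
  let v : s → lp (fun _ : ULift.{w} ℕ => ℂ) 2 := fun i => lp.single 2 ⟨e i⟩ (1 : ℂ)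
  have hv : Orthonormal ℂ v := by
    refine ⟨fun i => by simp [v], fun i j hij => ?_⟩
    have : (⟨e i⟩ : ULift.{w} ℕ) ≠ ⟨e j⟩ := fun h => hij (he (congrArg ULift.down h))
    simp [v, lp.inner_single_left, this]
  exact ⟨hv.orthogonalFamily.linearIsometry.comp b.repr.toLinearIsometry⟩

/-- Moore's theorem for a continuous positive definite kernel on a separable space. -/
theorem exists_inner_eq_kernel {S : Type*} [TopologicalSpace S] [TopologicalSpace.SeparableSpace S]
    {K : S → S → ℂ} (hK : Continuous fun p : S × S => K p.1 p.2)
    (pos : ∀ (n : ℕ) (x : Fin n → S) (c : Fin n → ℂ),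
      0 ≤ ∑ i, ∑ j, conj (c i) * c j * K (x i) (x j)) :
    ∃ k : S → lp (fun _ : ULift.{w} ℕ => ℂ) 2, ∀ x y, inner ℂ (k x) (k y) = K x y := by
  have herm := conj_eq_of_forall_sum_nonneg pos
  -- The scalar kernel as an operator-valued one on ℂ. Inner products conjugate the entries of `M`;
  -- `herm` then exchanges the two arguments of `K`.
  let M : Matrix S S (ℂ →L[ℂ] ℂ) := .of fun x y => K x y • ContinuousLinearMap.id ℂ ℂ
  have hM : M.PosSemidef := by
    refine ((RKHS.posSemidef_tfae (K := M)).out 0 2 rfl rfl).mpr ⟨?_, fun f => ?_⟩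
    · ext x y
      simp [M, Matrix.conjTranspose_apply, herm, ← ContinuousLinearMap.one_def]
    · have h := pos f.support.card (fun i => f.support.equivFin.symm i)
        (fun i => f (f.support.equivFin.symm i))
      have h' : f.sum (fun x w => f.sum fun x' w' => inner ℂ (M x' x w) w')
          = ∑ i, ∑ j, conj (f (f.support.equivFin.symm i)) * f (f.support.equivFin.symm j)
            * K (f.support.equivFin.symm i) (f.support.equivFin.symm j) := by
        rw [Equiv.sum_comp f.support.equivFin.symm (fun i => ∑ j, conj (f i)
          * f (f.support.equivFin.symm j) * K i (f.support.equivFin.symm j))]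
        rw [Finsupp.sum, ← Finset.sum_coe_sort]
        refine Finset.sum_congr rfl fun i _ => ?_
        rw [Equiv.sum_comp f.support.equivFin.symm (fun j => conj (f i) * f j * K i j)]
        rw [Finsupp.sum, ← Finset.sum_coe_sort]
        refine Finset.sum_congr rfl fun j _ => ?_
        simp [M, herm]
        ring
      rw [h']
      exact (Complex.le_def.mp h).1
  have : Fact M.PosSemidef := ⟨hM⟩
  let k₀ : S → RKHS.OfKernel M := fun x => RKHS.kerFun (RKHS.OfKernel M) x 1
  have hk₀ : ∀ x y, inner ℂ (k₀ x) (k₀ y) = K x y := by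
    intro x y
    have := RKHS.kernel_inner (RKHS.OfKernel M) y x 1 1
    rw [← this, RKHS.OfKernel.kernel_ofKernel]
    simp [M, herm]
  have hcont : Continuous k₀ := continuous_of_continuous_inner (by simpa only [hk₀] using hK)
  have hdense : Dense (Submodule.span ℂ (Set.range k₀) : Set (RKHS.OfKernel M)) := by
    rw [Submodule.dense_iff_topologicalClosure_eq_top, ← RKHS.kerFun_dense (RKHS.OfKernel M)]
    congr 1
    refine le_antisymm (Submodule.span_mono ?_) (Submodule.span_le.mpr ?_)
    · rintro _ ⟨x, rfl⟩
      exact ⟨x, 1, rfl⟩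
    · rintro _ ⟨x, c, rfl⟩
      have : RKHS.kerFun (RKHS.OfKernel M) x c = c • k₀ x := by
        rw [← map_smul]; simp
      rw [this]
      exact Submodule.smul_mem _ _ (Submodule.subset_span ⟨x, rfl⟩)
  have : TopologicalSpace.SeparableSpace (RKHS.OfKernel M) := by
    rw [← TopologicalSpace.isSeparable_univ_iff, ← hdense.closure_eq]
    exact ((TopologicalSpace.isSeparable_range hcont).span (R := ℂ)).closure
  -- The universe of the reproducing kernel space depends on `S`; the embedding into ℓ² moves the
  -- vectors to universe `w`.
  obtain ⟨V⟩ := exists_linearIsometry_lp.{w} (RKHS.OfKernel M)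
  exact ⟨fun x => V (k₀ x), fun x y => by rw [V.inner_map_map, hk₀]⟩

/-- The closed span of the range of `k`. -/
def closedSpan {S E : Type*} [NormedAddCommGroup E] [InnerProductSpace ℂ E] (k : S → E) :
    Submodule ℂ E :=
  (Submodule.span ℂ (Set.range k)).topologicalClosure

/-- The map `k`, with values in the closed span of its range. -/
def toClosedSpan {S E : Type*} [NormedAddCommGroup E] [InnerProductSpace ℂ E] (k : S → E)
    (x : S) : closedSpan k :=
  ⟨k x, Submodule.le_topologicalClosure _ (Submodule.subset_span ⟨x, rfl⟩)⟩

theorem inner_toClosedSpan {S E : Type*} [NormedAddCommGroup E] [InnerProductSpace ℂ E]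
    (k : S → E) (x y : S) : inner ℂ (toClosedSpan k x) (toClosedSpan k y) = inner ℂ (k x) (k y) :=
  rfl

theorem dense_span_toClosedSpan {S E : Type*} [NormedAddCommGroup E] [InnerProductSpace ℂ E]
    (k : S → E) : Dense (Submodule.span ℂ (Set.range (toClosedSpan k)) : Set (closedSpan k)) := by
  rw [Topology.IsInducing.subtypeVal.dense_iff]
  rintro ⟨z, hz⟩
  have h : (Submodule.span ℂ (Set.range k) : Set E)
      = Subtype.val '' (Submodule.span ℂ (Set.range (toClosedSpan k)) : Set (closedSpan k)) := by
    have := Submodule.map_span (closedSpan k).subtype (Set.range (toClosedSpan k))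
    rw [← Set.range_comp] at this
    exact (congrArg (fun p : Submodule ℂ E => (p : Set E)) this).symm
  exact h ▸ hz

theorem separableSpace_closedSpan {S E : Type*} [TopologicalSpace S]
    [TopologicalSpace.SeparableSpace S] [NormedAddCommGroup E] [InnerProductSpace ℂ E]
    {k : S → E} (hk : Continuous k) : TopologicalSpace.SeparableSpace (closedSpan k) :=
  (((TopologicalSpace.isSeparable_range hk).span (R := ℂ)).closure).separableSpace

/-- Two families with dense spans and the same Gram kernel are related by a unitary. -/
theorem exists_linearIsometryEquiv_of_inner_eq {S S' E E' : Type*} [NormedAddCommGroup E]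
    [InnerProductSpace ℂ E] [CompleteSpace E] [NormedAddCommGroup E'] [InnerProductSpace ℂ E']
    [CompleteSpace E'] (k : S → E) (k' : S' → E') (e : S ≃ S')
    (hk : Dense (Submodule.span ℂ (Set.range k) : Set E))
    (hk' : Dense (Submodule.span ℂ (Set.range k') : Set E'))
    (h : ∀ x y, inner ℂ (k' (e x)) (k' (e y)) = inner ℂ (k x) (k y)) :
    ∃ V : E ≃ₗᵢ[ℂ] E', ∀ x, V (k x) = k' (e x) := by
  -- Both spaces are completions of the finitely supported functions for the same seminorm, up to
  -- the relabelling `e`.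
  let f := Finsupp.domLCongr (R := ℂ) (M := ℂ) e
  let e₁ := Finsupp.linearCombination ℂ k
  let e₂ := Finsupp.linearCombination ℂ k'
  have h₁ : DenseRange e₁ := by
    rw [← Finsupp.range_linearCombination] at hk
    exact hk
  have h₂ : DenseRange e₂ := by
    rw [← Finsupp.range_linearCombination] at hk'
    exact hk'
  have hn : ∀ c, ‖e₂ (f c)‖ = ‖e₁ c‖ := by
    intro c
    have : inner ℂ (e₂ (f c)) (e₂ (f c)) = inner ℂ (e₁ c) (e₁ c) := by
      have h₃ : e₂ (f c) = Finsupp.linearCombination ℂ (fun x => k' (e x)) c := by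
        simp [e₂, f, Finsupp.domLCongr_apply, Finsupp.linearCombination_equivMapDomain,
          Function.comp_def]
      rw [h₃]
      simp only [e₁, Finsupp.linearCombination_apply, Finsupp.sum_inner, Finsupp.inner_sum, h,
        inner_smul_left, inner_smul_right]
    rw [@norm_eq_sqrt_re_inner ℂ, this, ← @norm_eq_sqrt_re_inner ℂ]
  refine ⟨f.extendOfIsometry e₁ e₂ h₁ h₂ hn, fun x => ?_⟩
  have := LinearEquiv.extendOfIsometry_eq f e₁ e₂ h₁ h₂ hn (Finsupp.single x 1)
  simpa [e₁, e₂, f] using this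

end FeatureMap

set_option linter.unusedSectionVars false

/-! ### Topology of the fibres and of the partial operations -/

section Topology

variable {X : Type u} [Groupoid.{v} X] [TopologicalSpace X] [TopologicalSpace (Quiver.Total X)]

theorem RFiber.toTotal_right {a : X} (x : RFiber a) : x.toTotal.right = a := rfl

theorem RFiber.isEmbedding_toTotal (a : X) : IsEmbedding (RFiber.toTotal (a := a)) where
  toIsInducing := ⟨rfl⟩
  injective := by
    rintro ⟨x⟩ ⟨y⟩ h
    simp only [RFiber.toTotal, Quiver.Total.mk.injEq] at h
    obtain ⟨rfl, -, h⟩ := h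
    rw [eq_of_heq h]

theorem RFiber.range_toTotal (a : X) :
    Set.range (RFiber.toTotal (a := a)) = {x : Quiver.Total X | x.right = a} := by
  ext x
  constructor
  · rintro ⟨y, rfl⟩
    rfl
  · rcases x with ⟨s, r, x⟩
    rintro rfl
    exact ⟨⟨x⟩, rfl⟩

instance instBorelSpaceRFiber (a : X) : BorelSpace (RFiber a) := ⟨rfl⟩

instance instSecondCountableRFiber (a : X) [SecondCountableTopology (Quiver.Total X)] :
    SecondCountableTopology (RFiber a) :=
  (RFiber.isEmbedding_toTotal a).secondCountableTopology

instance instT2SpaceRFiber (a : X) [T2Space (Quiver.Total X)] : T2Space (RFiber a) :=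
  (RFiber.isEmbedding_toTotal a).t2Space

variable [IsTopologicalGroupoid X]

theorem t2Space_units [T2Space (Quiver.Total X)] : T2Space X :=
  .of_injective_continuous (f := fun a : X => (⟨a, a, 𝟙 a⟩ : Quiver.Total X))
    (fun _ _ h => congrArg Quiver.Total.left h) IsTopologicalGroupoid.continuous_unit

theorem RFiber.isClosedEmbedding_toTotal [T2Space (Quiver.Total X)] (a : X) :
    IsClosedEmbedding (RFiber.toTotal (a := a)) where
  toIsEmbedding := RFiber.isEmbedding_toTotal a
  isClosed_range := by
    have := t2Space_units (X := X)
    rw [RFiber.range_toTotal]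
    exact isClosed_singleton.preimage IsTopologicalGroupoid.continuous_range

/-- The restriction of a compactly supported function on `G` to the fibre `G^a`. -/
theorem hasCompactSupport_comp_toTotal [T2Space (Quiver.Total X)] {E : Type*} [Zero E]
    [TopologicalSpace E] {f : Quiver.Total X → E} (hf : HasCompactSupport f) (a : X) :
    HasCompactSupport fun x : RFiber a => f x.toTotal :=
  hf.comp_isClosedEmbedding (RFiber.isClosedEmbedding_toTotal a)

/-- The arrow `y⁻¹ x`, for a pair `(x, y)` of arrows with the same range. -/
def leftDiv (q : {q : Quiver.Total X × Quiver.Total X // q.1.right = q.2.right}) :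
    Quiver.Total X :=
  ⟨q.1.1.left, q.1.2.left, q.1.1.hom ≫ eqToHom q.2 ≫ Groupoid.inv q.1.2.hom⟩

/-- Once the ranges are identified, this is inversion followed by multiplication; `eqToHom` only
transports along the propositional equality of ranges. -/
theorem continuous_leftDiv : Continuous (leftDiv (X := X)) := by
  let P : {q : Quiver.Total X × Quiver.Total X // q.1.right = q.2.right} → ComposablePair X :=
    fun q => ⟨q.1.1.hom, eqToHom q.2 ≫ Groupoid.inv q.1.2.hom⟩
  have hP : Continuous P := by
    rw [continuous_induced_rng]
    have h : ((fun p : ComposablePair X => ((⟨p.a, p.b, p.fst⟩, ⟨p.b, p.c, p.snd⟩) :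
        Quiver.Total X × Quiver.Total X)) ∘ P) = fun q => (q.1.1,
          ⟨q.1.2.right, q.1.2.left, Groupoid.inv q.1.2.hom⟩) := by
      funext ⟨⟨⟨a, b, x⟩, ⟨c, d, y⟩⟩, h⟩
      obtain rfl : b = d := h
      simp [P]
    rw [h]
    exact (continuous_fst.comp continuous_subtype_val).prodMk
      (IsTopologicalGroupoid.continuous_inv.comp (continuous_snd.comp continuous_subtype_val))
  exact IsTopologicalGroupoid.continuous_mul.comp hP

/-- The product `x z` for a pair `(x, z)` of composable arrows. -/
def mulOfEq (q : {q : Quiver.Total X × Quiver.Total X // q.2.right = q.1.left}) :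
    Quiver.Total X :=
  ⟨q.1.2.left, q.1.1.right, q.1.2.hom ≫ eqToHom q.2 ≫ q.1.1.hom⟩

theorem continuous_mulOfEq : Continuous (mulOfEq (X := X)) := by
  let P : {q : Quiver.Total X × Quiver.Total X // q.2.right = q.1.left} → ComposablePair X :=
    fun q => ⟨q.1.2.hom, eqToHom q.2 ≫ q.1.1.hom⟩
  have hP : Continuous P := by
    rw [continuous_induced_rng]
    have h : ((fun p : ComposablePair X => ((⟨p.a, p.b, p.fst⟩, ⟨p.b, p.c, p.snd⟩) :
        Quiver.Total X × Quiver.Total X)) ∘ P) = fun q => (q.1.2, q.1.1) := by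
      funext ⟨⟨⟨a, b, x⟩, ⟨c, d, y⟩⟩, h⟩
      obtain rfl : d = a := h
      simp [P]
    rw [h]
    exact (continuous_snd.comp continuous_subtype_val).prodMk
      (continuous_fst.comp continuous_subtype_val)
  exact IsTopologicalGroupoid.continuous_mul.comp hP

theorem continuous_invMul (a : X) :
    Continuous fun p : RFiber a × RFiber a => p.2.invMul p.1 := by
  have h : Continuous fun p : RFiber a × RFiber a =>
      (⟨(p.1.toTotal, p.2.toTotal), p.1.toTotal_right.trans p.2.toTotal_right.symm⟩ :
        {q : Quiver.Total X × Quiver.Total X // q.1.right = q.2.right}) := by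
    refine Continuous.subtype_mk ?_ _
    have := (RFiber.isEmbedding_toTotal a).continuous
    fun_prop
  convert continuous_leftDiv.comp h using 2 with p
  simp [leftDiv, RFiber.invMul, RFiber.toTotal]

end Topology

/-! ### Continuity of integrals over the fibres -/

section Haar

variable {X : Type u} [Groupoid.{v} X] [TopologicalSpace X] [TopologicalSpace (Quiver.Total X)]
  [IsTopologicalGroupoid X] [T2Space (Quiver.Total X)] (haar : LeftHaarSystem X)

instance instIsFiniteMeasureOnCompactsHaar (a : X) :
    IsFiniteMeasureOnCompacts (haar.measure a) :=
  have := haar.regular a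
  inferInstance

instance instIsOpenPosMeasureHaar (a : X) : (haar.measure a).IsOpenPosMeasure :=
  haar.full_support a

/-- The axiom applies because |f| is again in C_c(G). -/
theorem continuous_integral_norm (f : C_c(Quiver.Total X, ℂ)) :
    Continuous fun a : X => ∫ x : RFiber a, ‖f x.toTotal‖ ∂haar.measure a := by
  let g : C_c(Quiver.Total X, ℂ) := ⟨⟨fun x => (‖f x‖ : ℂ), by fun_prop⟩,
    f.hasCompactSupport.comp_left (g := fun z : ℂ => (‖z‖ : ℂ)) (by simp)⟩
  have h := Complex.continuous_re.comp (haar.continuous_integral g)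
  have h' : ∀ a, ∫ x : RFiber a, g x.toTotal ∂haar.measure a
      = ((∫ x : RFiber a, ‖f x.toTotal‖ ∂haar.measure a : ℝ) : ℂ) := fun a =>
    integral_ofReal
  simpa only [Function.comp_def, h', Complex.ofReal_re] using h

theorem integrable_smul_of_hasCompactSupport {E : Type*} [NormedAddCommGroup E] [NormedSpace ℂ E]
    [SecondCountableTopology (Quiver.Total X)] {a : X}
    {v : RFiber a → E} (hv : Continuous v) (f : C_c(Quiver.Total X, ℂ)) :
    Integrable (fun x : RFiber a => f x.toTotal • v x) (haar.measure a) := by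
  have hc := (RFiber.isEmbedding_toTotal a).continuous
  refine Continuous.integrable_of_hasCompactSupport (by fun_prop) ?_
  exact (hasCompactSupport_comp_toTotal f.hasCompactSupport a).smul_right

/-- Integrals over the fibres depend continuously on parameters. -/
theorem continuous_integral_param [LocallyCompactSpace (Quiver.Total X)]
    [SecondCountableTopology (Quiver.Total X)] {Y : Type*} [TopologicalSpace Y]
    {p : Y → X} (hp : Continuous p) {F : {q : Y × Quiver.Total X // q.2.right = p q.1} → ℂ}
    (hF : Continuous F) (f : C_c(Quiver.Total X, ℂ)) :
    Continuous fun y => ∫ x : RFiber (p y),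
      f x.toTotal * F ⟨(y, x.toTotal), x.toTotal_right⟩ ∂haar.measure (p y) := by
  have := t2Space_units (X := X)
  have hcF : ∀ y, Continuous fun x : RFiber (p y) => F ⟨(y, x.toTotal), x.toTotal_right⟩ := fun y =>
    hF.comp (Continuous.subtype_mk
      (by have := (RFiber.isEmbedding_toTotal (p y)).continuous; fun_prop) _)
  rw [continuous_iff_continuousAt]
  intro y₀
  -- Tietze: F(y₀, ·) extends from the closed fibre to all of G. The Haar system axiom then handles
  -- f g, and it remains to compare F(y, ·) with g for y near y₀.
  obtain ⟨g, hg⟩ := ContinuousMap.exists_extension' (RFiber.isClosedEmbedding_toTotal (p y₀))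
    ⟨_, hcF y₀⟩
  have hg' : ∀ x : RFiber (p y₀), g x.toTotal = F ⟨(y₀, x.toTotal), x.toTotal_right⟩ := fun x =>
    congrFun hg x
  let ψ : C_c(Quiver.Total X, ℂ) := ⟨⟨fun x => f x * g x, by fun_prop⟩,
    f.hasCompactSupport.mul_right⟩
  have h1 : ContinuousAt (fun y => ∫ x : RFiber (p y), ψ x.toTotal ∂haar.measure (p y)) y₀ :=
    ((haar.continuous_integral ψ).comp hp).continuousAt
  have h2 : ContinuousAt
      (fun y => ∫ x : RFiber (p y), ‖f x.toTotal‖ ∂haar.measure (p y)) y₀ :=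
    ((continuous_integral_norm haar f).comp hp).continuousAt
  set N := ∫ x : RFiber (p y₀), ‖f x.toTotal‖ ∂haar.measure (p y₀) with hN
  have hN0 : 0 ≤ N := integral_nonneg fun _ => norm_nonneg _
  have h0 : ∫ x : RFiber (p y₀), f x.toTotal * F ⟨(y₀, x.toTotal), x.toTotal_right⟩ ∂haar.measure (p y₀)
      = ∫ x : RFiber (p y₀), ψ x.toTotal ∂haar.measure (p y₀) := by
    refine integral_congr_ae (.of_forall fun x => ?_)
    simp [ψ, hg']
  rw [Metric.continuousAt_iff'] at h1 ⊢
  intro ε hε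
  -- On fibres over nearby points ∫ |f| is below N + 1, so this uniform error costs at most ε / 2.
  have hδ : 0 < ε / (2 * (N + 1)) := by positivity
  have h3 : ∀ᶠ y in 𝓝 y₀, ∀ x ∈ tsupport f, ∀ h : x.right = p y,
      ‖F ⟨(y, x), h⟩ - g x‖ ≤ ε / (2 * (N + 1)) := by
    refine f.hasCompactSupport.isCompact.eventually_forall_of_forall_eventually fun x _ => ?_
    by_cases hx : x.right = p y₀
    · have hc : Continuous fun q : {q : Y × Quiver.Total X // q.2.right = p q.1} =>
          ‖F q - g q.1.2‖ := by fun_prop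
      have h0 : ‖F ⟨(y₀, x), hx⟩ - g x‖ = 0 := by
        rcases x with ⟨s, r, x⟩
        obtain rfl : r = p y₀ := hx
        have := hg' ⟨x⟩
        simp only [RFiber.toTotal] at this
        simp [this]
      have := (hc.tendsto ⟨(y₀, x), hx⟩).eventually_le_const (h0 ▸ hδ)
      rw [nhds_subtype_eq_comap, Filter.eventually_comap] at this
      filter_upwards [this] with z hz h
      exact hz ⟨z, h⟩ rfl
    -- Away from the closed set r(x) = p(y) the condition is locally vacuous.
    · have ho : IsOpen {z : Y × Quiver.Total X | z.2.right ≠ p z.1} :=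
        (isClosed_eq (IsTopologicalGroupoid.continuous_range.comp continuous_snd)
          (hp.comp continuous_fst)).isOpen_compl
      filter_upwards [ho.mem_nhds hx] with z hz h
      exact absurd h hz
  filter_upwards [h1 (ε / 2) (half_pos hε), h3, h2.eventually_lt_const (lt_add_one N)]
    with y hy1 hy2 hy3
  rw [h0]
  have h4 : dist (∫ x : RFiber (p y), f x.toTotal * F ⟨(y, x.toTotal), x.toTotal_right⟩ ∂haar.measure (p y))
      (∫ x : RFiber (p y), ψ x.toTotal ∂haar.measure (p y)) ≤ ε / 2 := by
    have hi := integrable_smul_of_hasCompactSupport haar (hcF y) f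
    have hgc : Continuous fun x : RFiber (p y) => g x.toTotal :=
      g.continuous.comp (RFiber.isEmbedding_toTotal (p y)).continuous
    have hi' := integrable_smul_of_hasCompactSupport haar hgc f
    have hn := (integrable_smul_of_hasCompactSupport haar
      (continuous_const (y := (1 : ℂ)) : Continuous fun _ : RFiber (p y) => (1 : ℂ)) f).norm
    simp only [smul_eq_mul, mul_one] at hi hi' hn
    have hψ : ∫ x : RFiber (p y), ψ x.toTotal ∂haar.measure (p y)
        = ∫ x : RFiber (p y), f x.toTotal * g x.toTotal ∂haar.measure (p y) := rfl
    rw [dist_eq_norm, hψ, ← integral_sub hi hi']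
    calc _ ≤ ∫ x : RFiber (p y), ‖f x.toTotal‖ * (ε / (2 * (N + 1))) ∂haar.measure (p y) := by
          refine norm_integral_le_of_norm_le (hn.mul_const _) (.of_forall fun x => ?_)
          rw [← mul_sub, norm_mul]
          by_cases hx : x.toTotal ∈ tsupport f
          · exact mul_le_mul_of_nonneg_left (hy2 _ hx x.toTotal_right) (norm_nonneg _)
          · simp [image_eq_zero_of_notMem_tsupport hx]
      _ = (∫ x : RFiber (p y), ‖f x.toTotal‖ ∂haar.measure (p y)) * (ε / (2 * (N + 1))) :=
          integral_mul_const _ _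
      _ ≤ (N + 1) * (ε / (2 * (N + 1))) := by gcongr
      _ = ε / 2 := by field_simp
  calc _ ≤ _ := dist_triangle _ _ _
    _ < ε / 2 + ε / 2 := add_lt_add_of_le_of_lt h4 hy1
    _ = ε := add_halves ε

end Haar

/-! ### Inner products of fibre integrals; coefficients are positive definite -/

section Integral

variable {X : Type u} [Groupoid.{v} X] [TopologicalSpace X] [TopologicalSpace (Quiver.Total X)]
  [IsTopologicalGroupoid X] [T2Space (Quiver.Total X)]
  [SecondCountableTopology (Quiver.Total X)] (haar : LeftHaarSystem X)

/-- Integrals of inner products of two weighted families of vectors on a fibre. -/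
theorem inner_integral_smul {E : Type*} [NormedAddCommGroup E]
    [InnerProductSpace ℂ E] [CompleteSpace E] {a b : X} {v : RFiber a → E} {w : RFiber b → E}
    (hv : Continuous v) (hw : Continuous w) (f g : C_c(Quiver.Total X, ℂ)) :
    inner ℂ (∫ x : RFiber a, f x.toTotal • v x ∂haar.measure a)
      (∫ y : RFiber b, g y.toTotal • w y ∂haar.measure b)
      = ∫ y : RFiber b, g y.toTotal * ∫ x : RFiber a,
          conj (f x.toTotal) * inner ℂ (v x) (w y) ∂haar.measure a ∂haar.measure b := by
  rw [← integral_inner (integrable_smul_of_hasCompactSupport haar hw g)]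
  refine integral_congr_ae (.of_forall fun y => ?_)
  simp only [inner_smul_right]
  congr 1
  -- `integral_inner` acts on the second slot only; conjugate symmetry gives the first.
  rw [← inner_conj_symm, ← integral_inner (integrable_smul_of_hasCompactSupport haar hv f),
    ← integral_conj]
  refine integral_congr_ae (.of_forall fun x => ?_)
  simp only [inner_smul_right, map_mul, inner_conj_symm]

end Integral

section Coefficient

variable {X : Type u} [Groupoid.{v} X] [TopologicalSpace X] [TopologicalSpace (Quiver.Total X)]

/-- Apply the isometry L_y to both entries and use y(y⁻¹x) = x. -/
theorem GHilbertBundle.coefficient_invMul (H : GHilbertBundle.{u, v, w} X) (ξ : ∀ a, H.fiber a)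
    {a : X} (y x : RFiber a) :
    H.coefficient ξ ξ (y.invMul x) = inner ℂ (H.L x.hom (ξ x.source)) (H.L y.hom (ξ y.source)) := by
  change inner ℂ (H.L (x.hom ≫ Groupoid.inv y.hom) (ξ x.source)) (ξ y.source) = _
  rw [H.L_comp, ← (H.L y.hom).inner_map_map, ← H.L_comp, Groupoid.inv_comp, H.L_id]

/-- A diagonal coefficient of a `G`-Hilbert bundle is positive definite. -/
theorem isPositiveDefinite_of_eq_coefficient [IsTopologicalGroupoid X] [T2Space (Quiver.Total X)]
    [SecondCountableTopology (Quiver.Total X)] (haar : LeftHaarSystem X) {φ : Quiver.Total X →ᵇ ℂ}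
    (H : GHilbertBundle.{u, v, w} X) (ξ : ∀ a, H.fiber a)
    (h : ∀ x : Quiver.Total X, φ x = H.coefficient ξ ξ x) : IsPositiveDefinite haar φ := by
  intro a f
  let v : RFiber a → H.fiber a := fun x => H.L x.hom (ξ x.source)
  have hφ : ∀ x y : RFiber a, φ (y.invMul x) = inner ℂ (v x) (v y) := fun x y => by
    rw [h, H.coefficient_invMul]
  -- Continuity is read off from the Gram kernel, which is φ(y⁻¹x).
  have hv : Continuous v := by
    refine continuous_of_continuous_inner ?_
    simp only [← hφ]
    exact φ.continuous.comp (continuous_invMul a)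
  have h1 := inner_integral_smul haar hv hv f f
  have h2 : ∫ y : RFiber a, ∫ x : RFiber a, φ (y.invMul x) * f y.toTotal * conj (f x.toTotal)
      ∂haar.measure a ∂haar.measure a = inner ℂ (∫ x : RFiber a, f x.toTotal • v x ∂haar.measure a)
        (∫ x : RFiber a, f x.toTotal • v x ∂haar.measure a) := by
    rw [h1]
    refine integral_congr_ae (.of_forall fun y => ?_)
    simp only [← integral_const_mul]
    refine integral_congr_ae (.of_forall fun x => ?_)
    simp only [hφ]
    ring
  rw [h2, inner_self_eq_norm_sq_to_K]
  rw [RCLike.ofReal_eq_complex_ofReal, ← Complex.ofReal_pow]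
  exact Complex.zero_le_real.mpr (sq_nonneg _)

end Coefficient

/-! ### From integral positivity to pointwise positivity -/

section Bump

variable {X : Type u} [Groupoid.{v} X] [TopologicalSpace X] [TopologicalSpace (Quiver.Total X)]
  [IsTopologicalGroupoid X] [T2Space (Quiver.Total X)]
  [SecondCountableTopology (Quiver.Total X)] (haar : LeftHaarSystem X)

/-- A weighted integral of vectors close to `z` is close to the total weight times `z`. -/
theorem norm_integral_smul_sub_le {E : Type*} [NormedAddCommGroup E]
    [NormedSpace ℂ E] [CompleteSpace E] {a : X} {v : RFiber a → E} (hv : Continuous v)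
    {f : C_c(Quiver.Total X, ℂ)} (hf : ∀ x, f x = ‖f x‖) (z : E) {ε : ℝ}
    (h : ∀ x : RFiber a, f x.toTotal ≠ 0 → ‖v x - z‖ ≤ ε) :
    ‖∫ x : RFiber a, f x.toTotal • v x ∂haar.measure a
        - ((∫ x : RFiber a, ‖f x.toTotal‖ ∂haar.measure a : ℝ) : ℂ) • z‖
      ≤ (∫ x : RFiber a, ‖f x.toTotal‖ ∂haar.measure a) * ε := by
  have h1 : ((∫ x : RFiber a, ‖f x.toTotal‖ ∂haar.measure a : ℝ) : ℂ) • z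
      = ∫ x : RFiber a, f x.toTotal • z ∂haar.measure a := by
    rw [integral_smul_const]
    congr 1
    exact integral_ofReal.symm.trans (integral_congr_ae (.of_forall fun x => (hf _).symm))
  have hn : Integrable (fun x : RFiber a => ‖f x.toTotal‖) (haar.measure a) := by
    simpa using (integrable_smul_of_hasCompactSupport haar
      (continuous_const (y := (1 : ℂ)) : Continuous fun _ : RFiber a => (1 : ℂ)) f).norm
  rw [h1, ← integral_sub (integrable_smul_of_hasCompactSupport haar hv f)
    (integrable_smul_of_hasCompactSupport haar continuous_const f), ← integral_mul_const]
  refine norm_integral_le_of_norm_le (hn.mul_const _) (.of_forall fun x => ?_)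
  rw [← smul_sub, norm_smul]
  by_cases hx : f x.toTotal = 0
  · simp [hx]
  · exact mul_le_mul_of_nonneg_left (h x hx) (norm_nonneg _)

variable [LocallyCompactSpace (Quiver.Total X)]

/-- Normalized nonnegative functions with small support around a point of a fibre. -/
theorem exists_normalized_bump {a : X} (x₀ : RFiber a) {U : Set (Quiver.Total X)}
    (hU : U ∈ 𝓝 x₀.toTotal) : ∃ f : C_c(Quiver.Total X, ℂ), (∀ x, f x = ‖f x‖) ∧
      (∀ x, f x ≠ 0 → x ∈ U) ∧ ∫ x : RFiber a, ‖f x.toTotal‖ ∂haar.measure a = 1 := by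
  obtain ⟨g, hg1, hg0, hgc, hg⟩ := exists_continuous_one_zero_of_isCompact
    (isCompact_singleton (x := x₀.toTotal)) (isOpen_interior (s := U)).isClosed_compl
    (by simpa using mem_interior_iff_mem_nhds.mpr hU)
  have hg₀ : ∀ x, 0 ≤ g x := fun x => (hg x).1
  set N := ∫ x : RFiber a, g x.toTotal ∂haar.measure a with hN
  have hN0 : 0 < N := by
    refine Continuous.integral_pos_of_hasCompactSupport_nonneg_nonzero (x := x₀)
      (g.continuous.comp (RFiber.isEmbedding_toTotal a).continuous)
      (hasCompactSupport_comp_toTotal hgc a) (fun x => hg₀ _) ?_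
    rw [hg1 rfl]
    exact one_ne_zero
  let f : C_c(Quiver.Total X, ℂ) := ⟨⟨fun x => ((N⁻¹ * g x : ℝ) : ℂ), by fun_prop⟩,
    hgc.comp_left (g := fun t : ℝ => ((N⁻¹ * t : ℝ) : ℂ)) (by simp)⟩
  have hf : ∀ x, f x = ((N⁻¹ * g x : ℝ) : ℂ) := fun _ => rfl
  have hfn : ∀ x, ‖f x‖ = N⁻¹ * g x := fun x => by
    rw [hf, Complex.norm_real, Real.norm_of_nonneg (mul_nonneg (by positivity) (hg₀ x))]
  refine ⟨f, fun x => by rw [hfn, hf], fun x hx => ?_, ?_⟩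
  · by_contra h
    refine hx ?_
    rw [hf, hg0 (fun h' => h (interior_subset h'))]
    simp
  · simp only [hfn]
    rw [integral_const_mul, ← hN, inv_mul_cancel₀ hN0.ne']

/-- Makes the inner integral an admissible integrand for a second average, in y. -/
theorem continuous_integral_mul_kernel (φ : Quiver.Total X →ᵇ ℂ) (a : X)
    (f : C_c(Quiver.Total X, ℂ)) :
    Continuous fun y : RFiber a => ∫ x : RFiber a, f x.toTotal * φ (y.invMul x)
      ∂haar.measure a := by
  have hF : Continuous fun q : {q : RFiber a × Quiver.Total X // q.2.right = a} =>
      φ (leftDiv ⟨(q.1.2, q.1.1.toTotal), q.2.trans q.1.1.toTotal_right.symm⟩) := by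
    refine φ.continuous.comp (continuous_leftDiv.comp (Continuous.subtype_mk ?_ _))
    have := (RFiber.isEmbedding_toTotal a).continuous
    fun_prop
  convert continuous_integral_param haar (p := fun _ : RFiber a => a) continuous_const hF f
    using 5 with y x
  simp [leftDiv, RFiber.invMul, RFiber.toTotal]

/-- A positive definite function on a groupoid gives positive definite kernels on the fibres. -/
theorem IsPositiveDefinite.sum_nonneg {haar : LeftHaarSystem X} {φ : Quiver.Total X →ᵇ ℂ}
    (hφ : IsPositiveDefinite haar φ) {a : X} (n : ℕ) (x : Fin n → RFiber a) (c : Fin n → ℂ) :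
    0 ≤ ∑ i, ∑ j, conj (c i) * c j * φ ((x j).invMul (x i)) := by
  have hK : Continuous fun p : RFiber a × RFiber a => φ (p.2.invMul p.1) :=
    φ.continuous.comp (continuous_invMul a)
  set M := ∑ i, ∑ j, ‖c i‖ * ‖c j‖ with hM
  have hM0 : 0 ≤ M := by positivity
  -- The nonnegative cone is closed, so it suffices to approximate the sum by the integrals for f =
  -- ∑ c_i f_i, with f_i a bump at x_i.
  refine (isClosed_Ici (a := (0 : ℂ))).closure_subset (Metric.mem_closure_iff.mpr fun ε hε => ?_)
  have hδ : 0 < ε / (M + 1) := by positivity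
  have h1 : ∀ i j, ∃ U ∈ 𝓝 (x i), ∃ V ∈ 𝓝 (x j), ∀ y ∈ U, ∀ z ∈ V,
      ‖φ (z.invMul y) - φ ((x j).invMul (x i))‖ ≤ ε / (M + 1) := by
    intro i j
    have hc : Continuous fun p : RFiber a × RFiber a =>
      ‖φ (p.2.invMul p.1) - φ ((x j).invMul (x i))‖ :=
        (hK.sub continuous_const).norm
    have := (hc.tendsto (x i, x j)).eventually_le_const (u := ε / (M + 1)) (by simpa using hδ)
    rw [nhds_prod_eq, Filter.eventually_prod_iff] at this
    obtain ⟨p, hp, q, hq, h⟩ := this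
    exact ⟨_, hp, _, hq, fun y hy z hz => h hy hz⟩
  choose U hU V hV hUV using h1
  have h2 : ∀ i, ∃ f : C_c(Quiver.Total X, ℂ), (∀ x, f x = ‖f x‖) ∧
      (∀ y : RFiber a, f y.toTotal ≠ 0 → ∀ j, y ∈ U i j ∧ y ∈ V j i) ∧
      ∫ x : RFiber a, ‖f x.toTotal‖ ∂haar.measure a = 1 := by
    intro i
    -- The same bump at x_i must serve in both variables and against every x_j.
    have hW : (⋂ j, U i j ∩ V j i) ∈ 𝓝 (x i) :=
      Filter.iInter_mem.mpr fun j => Filter.inter_mem (hU i j) (hV j i)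
    rw [(RFiber.isEmbedding_toTotal a).nhds_eq_comap] at hW
    obtain ⟨W, hW, hWU⟩ := hW
    obtain ⟨f, hf, hf', hf1⟩ := exists_normalized_bump haar (x i) hW
    exact ⟨f, hf, fun y hy => Set.mem_iInter.mp (hWU (hf' _ hy)), hf1⟩
  choose f hf hfU hf1 using h2
  have hh : ∀ i, Continuous fun y : RFiber a => ∫ x : RFiber a,
      f i x.toTotal * φ (y.invMul x) ∂haar.measure a :=
    fun i => continuous_integral_mul_kernel haar φ a (f i)
  -- The averaging estimate, used in x for fixed y and then in y.
  have h3 : ∀ i j, ‖∫ y : RFiber a, f j y.toTotal * ∫ x : RFiber a,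
      f i x.toTotal * φ (y.invMul x) ∂haar.measure a ∂haar.measure a
        - φ ((x j).invMul (x i))‖ ≤ ε / (M + 1) := by
    intro i j
    have := norm_integral_smul_sub_le haar (hh i) (hf j) (φ ((x j).invMul (x i)))
      (ε := ε / (M + 1)) fun y hy => by
        have := norm_integral_smul_sub_le haar (v := fun x => φ (y.invMul x))
          (φ.continuous.comp ((continuous_invMul a).comp (Continuous.prodMk_left y))) (hf i)
          (φ ((x j).invMul (x i))) (ε := ε / (M + 1))
          fun z hz => hUV i j z (hfU i z hz j).1 y (hfU j y hy i).2
        simpa [hf1] using this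
    simpa [hf1] using this
  have h4 : ∫ y : RFiber a, ∫ z : RFiber a, φ (y.invMul z) * (∑ j, c j • f j) y.toTotal
      * conj ((∑ i, c i • f i) z.toTotal) ∂haar.measure a ∂haar.measure a
      = ∑ i, ∑ j, conj (c i) * c j * ∫ y : RFiber a, f j y.toTotal * ∫ x : RFiber a,
        f i x.toTotal * φ (y.invMul x) ∂haar.measure a ∂haar.measure a := by
    have hin : ∀ y : RFiber a, ∫ z : RFiber a, φ (y.invMul z) * (∑ j, c j • f j) y.toTotal
        * conj ((∑ i, c i • f i) z.toTotal) ∂haar.measure a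
        = ∑ i, ∑ j, conj (c i) * c j * (f j y.toTotal * ∫ x : RFiber a,
          f i x.toTotal * φ (y.invMul x) ∂haar.measure a) := by
      intro y
      have hi : ∀ i j, Integrable (fun z : RFiber a => conj (c i) * c j * (f j y.toTotal
          * (f i z.toTotal * φ (y.invMul z)))) (haar.measure a) := fun i j =>
        ((integrable_smul_of_hasCompactSupport haar (v := fun z => φ (y.invMul z))
          (φ.continuous.comp ((continuous_invMul a).comp (Continuous.prodMk_left y)))
          (f i)).const_mul _).const_mul _
      simp only [← integral_const_mul]
      have hs : ∀ i, ∑ j, ∫ z : RFiber a, conj (c i) * c j * (f j y.toTotal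
          * (f i z.toTotal * φ (y.invMul z))) ∂haar.measure a = ∫ z : RFiber a,
          ∑ j, conj (c i) * c j * (f j y.toTotal * (f i z.toTotal * φ (y.invMul z)))
            ∂haar.measure a := fun i => (integral_finsetSum _ fun j _ => hi i j).symm
      simp only [hs]
      rw [← integral_finsetSum _ fun i _ => integrable_finsetSum _ fun j _ => hi i j]
      refine integral_congr_ae (.of_forall fun z => ?_)
      -- The bumps are real, so conjugation affects only the weights c_i.
      have hconj : ∀ i, conj (f i z.toTotal) = f i z.toTotal := fun i => by
        rw [hf, Complex.conj_ofReal]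
      simp only [CompactlySupportedContinuousMap.sum_apply,
        CompactlySupportedContinuousMap.smul_apply, smul_eq_mul, map_sum, map_mul, hconj,
        Finset.mul_sum, Finset.sum_mul]
      refine Finset.sum_congr rfl fun i _ => Finset.sum_congr rfl fun j _ => ?_
      ring
    have hj : ∀ i j, Integrable (fun y : RFiber a => conj (c i) * c j * (f j y.toTotal
        * ∫ x : RFiber a, f i x.toTotal * φ (y.invMul x) ∂haar.measure a)) (haar.measure a) :=
      fun i j => (integrable_smul_of_hasCompactSupport haar (hh i) (f j)).const_mul _
    simp only [hin]
    rw [integral_finsetSum _ fun i _ => integrable_finsetSum _ fun j _ => hj i j]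
    refine Finset.sum_congr rfl fun i _ => ?_
    rw [integral_finsetSum _ fun j _ => hj i j]
    exact Finset.sum_congr rfl fun j _ => integral_const_mul _ _
  refine ⟨_, hφ a (∑ i, c i • f i), ?_⟩
  rw [h4, dist_eq_norm, ← Finset.sum_sub_distrib]
  calc _ ≤ ∑ i, ∑ j, ‖c i‖ * ‖c j‖ * (ε / (M + 1)) := by
        refine (norm_sum_le _ _).trans (Finset.sum_le_sum fun i _ => ?_)
        rw [← Finset.sum_sub_distrib]
        refine (norm_sum_le _ _).trans (Finset.sum_le_sum fun j _ => ?_)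
        rw [← mul_sub, norm_mul, norm_mul, RCLike.norm_conj, norm_sub_rev]
        exact mul_le_mul_of_nonneg_left (h3 i j) (by positivity)
    _ = M * (ε / (M + 1)) := by simp only [hM, Finset.sum_mul]
    _ < ε := by
        rw [← mul_div_assoc, div_lt_iff₀ (by positivity)]
        nlinarith

end Bump

/-! ### Left translation between fibres -/

section Translate

variable {X : Type u} [Groupoid.{v} X]

theorem RFiber.translate_id {a : X} (x : RFiber a) : x.translate (𝟙 a) = x := by
  simp [RFiber.translate]

theorem RFiber.translate_comp {a b c : X} (y : a ⟶ b) (x : b ⟶ c) (z : RFiber a) :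
    z.translate (y ≫ x) = (z.translate y).translate x := by
  simp [RFiber.translate]

/-- This invariance of the kernel is what makes translation act unitarily. -/
theorem RFiber.invMul_translate {a b : X} (g : a ⟶ b) (y x : RFiber a) :
    (y.translate g).invMul (x.translate g) = y.invMul x := by
  simp [RFiber.translate, RFiber.invMul, Groupoid.inv_eq_inv]

/-- Left translation as a bijection of fibres. -/
def RFiber.translateEquiv {a b : X} (g : a ⟶ b) : RFiber a ≃ RFiber b where
  toFun x := x.translate g
  invFun x := x.translate (Groupoid.inv g)
  left_inv x := by
    change (x.translate g).translate _ = x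
    rw [← RFiber.translate_comp, Groupoid.comp_inv, RFiber.translate_id]
  right_inv x := by
    change (x.translate _).translate g = x
    rw [← RFiber.translate_comp, Groupoid.inv_comp, RFiber.translate_id]

end Translate

/-! ### The Hilbert spaces generated by a positive definite function -/

theorem continuous_of_forall_exists_dist_le {α β : Type*} [TopologicalSpace α]
    [PseudoMetricSpace β] {f : α → β} (h : ∀ a, ∀ ε > (0 : ℝ), ∃ g : α → β, Continuous g ∧
      ∀ᶠ b in 𝓝 a, dist (f b) (g b) ≤ ε) : Continuous f := by
  refine continuous_of_locally_uniform_approx_of_continuousAt fun a V hV => ?_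
  obtain ⟨ε, hε, hV⟩ := Metric.mem_uniformity_dist.mp hV
  obtain ⟨g, hg, hfg⟩ := h a (ε / 2) (half_pos hε)
  exact ⟨_, hfg, g, hg.continuousAt, fun b hb => hV (lt_of_le_of_lt hb (half_lt_self hε))⟩

/-- A bundle of Hilbert spaces, not yet topologized, generated by vectors indexed by the arrows
whose Gram kernel is given by `φ`, with the action of the arrows by left translation. -/
structure FeatureBundle {X : Type u} [Groupoid.{v} X] (φ : Quiver.Total X → ℂ) where
  fiber : X → Type w
  [normedAddCommGroup : ∀ a, NormedAddCommGroup (fiber a)]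
  [innerProductSpace : ∀ a, InnerProductSpace ℂ (fiber a)]
  [completeSpace : ∀ a, CompleteSpace (fiber a)]
  [separableSpace : ∀ a, TopologicalSpace.SeparableSpace (fiber a)]
  vec : ∀ {a : X}, RFiber a → fiber a
  inner_vec : ∀ {a : X} (x y : RFiber a), inner ℂ (vec x) (vec y) = φ (y.invMul x)
  dense_span : ∀ a, Dense (Submodule.span ℂ (Set.range (vec (a := a))) : Set (fiber a))
  L : ∀ {a b : X}, (a ⟶ b) → (fiber a ≃ₗᵢ[ℂ] fiber b)
  L_vec : ∀ {a b : X} (g : a ⟶ b) (x : RFiber a), L g (vec x) = vec (x.translate g)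

attribute [instance] FeatureBundle.normedAddCommGroup FeatureBundle.innerProductSpace
  FeatureBundle.completeSpace FeatureBundle.separableSpace

variable {X : Type u} [Groupoid.{v} X] [TopologicalSpace X] [TopologicalSpace (Quiver.Total X)]
  [IsTopologicalGroupoid X] [T2Space (Quiver.Total X)]
  [SecondCountableTopology (Quiver.Total X)] {haar : LeftHaarSystem X}
  {φ : Quiver.Total X →ᵇ ℂ}

/-- The fibres are the closed spans of the ranges of the k_a inside the one space E; equality of
Gram kernels under translation yields the unitaries. -/
theorem nonempty_featureBundle_of_inner_eq {E : Type w} [NormedAddCommGroup E]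
    [InnerProductSpace ℂ E] [CompleteSpace E] {k : ∀ a : X, RFiber a → E}
    (hk : ∀ a x y, inner ℂ (k a x) (k a y) = φ (y.invMul x)) :
    Nonempty (FeatureBundle.{u, v, w} (φ : Quiver.Total X → ℂ)) := by
  have hkc : ∀ a, Continuous (k a) := fun a => continuous_of_continuous_inner (by
    simp only [hk]
    exact φ.continuous.comp (continuous_invMul a))
  have hsep : ∀ a, TopologicalSpace.SeparableSpace (closedSpan (k a)) := fun a =>
    separableSpace_closedSpan (hkc a)
  have hcomp : ∀ a, CompleteSpace (closedSpan (k a)) := fun a =>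
    Submodule.topologicalClosure.completeSpace _
  have hin : ∀ a x y, inner ℂ (toClosedSpan (k a) x) (toClosedSpan (k a) y)
      = φ (y.invMul x) := fun a x y =>
    (inner_toClosedSpan (k a) x y).trans (hk a x y)
  have hL : ∀ (a b : X) (g : a ⟶ b), ∃ V : closedSpan (k a) ≃ₗᵢ[ℂ] closedSpan (k b),
      ∀ x, V (toClosedSpan (k a) x) = toClosedSpan (k b) (x.translate g) := fun a b g =>
    exists_linearIsometryEquiv_of_inner_eq _ _ (RFiber.translateEquiv g)
      (dense_span_toClosedSpan (k a)) (dense_span_toClosedSpan (k b)) fun x y => by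
        rw [hin, hin]
        exact congrArg φ (RFiber.invMul_translate g y x)
  choose V hV using hL
  exact ⟨{ fiber := fun a => closedSpan (k a)
           vec := fun {a} => toClosedSpan (k a)
           inner_vec := fun {a} => hin a
           dense_span := fun a => dense_span_toClosedSpan (k a)
           L := fun {a b} => V a b
           L_vec := fun {a b} => hV a b }⟩

theorem IsPositiveDefinite.nonempty_featureBundle [LocallyCompactSpace (Quiver.Total X)]
    (hφ : IsPositiveDefinite haar φ) :
    Nonempty (FeatureBundle.{u, v, w} (φ : Quiver.Total X → ℂ)) := by
  have h : ∀ a : X, ∃ k : RFiber a → lp (fun _ : ULift.{w} ℕ => ℂ) 2,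
      ∀ x y, inner ℂ (k x) (k y) = φ (y.invMul x) := by
    intro a
    have h := exists_inner_eq_kernel.{w} (K := fun x y : RFiber a => φ (y.invMul x))
      (φ.continuous.comp (continuous_invMul a))
    beta_reduce at h
    exact h hφ.sum_nonneg
  choose k hk using h
  exact nonempty_featureBundle_of_inner_eq hk

/-! ### The continuous field and the section of units -/

namespace FeatureBundle

variable (B : FeatureBundle.{u, v, w} (φ : Quiver.Total X → ℂ))

theorem continuous_vec (a : X) : Continuous (B.vec (a := a)) := by
  refine continuous_of_continuous_inner ?_
  simp only [B.inner_vec]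
  exact φ.continuous.comp (continuous_invMul a)

/-- Reduces the functoriality of L to that of translation on the generating vectors. -/
theorem clm_ext {E : Type*} [NormedAddCommGroup E] [NormedSpace ℂ E] {a : X}
    {S T : B.fiber a →L[ℂ] E} (h : ∀ x, S (B.vec x) = T (B.vec x)) : S = T :=
  ContinuousLinearMap.ext_on (B.dense_span a) (by rintro _ ⟨x, rfl⟩; exact h x)

theorem L_id (a : X) (z : B.fiber a) : B.L (𝟙 a) z = z := by
  have : ((B.L (𝟙 a)).toContinuousLinearEquiv : B.fiber a →L[ℂ] B.fiber a)
      = ContinuousLinearMap.id ℂ _ :=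
    B.clm_ext fun x => by simp [B.L_vec, RFiber.translate_id]
  exact congrArg (fun T : B.fiber a →L[ℂ] B.fiber a => T z) this

theorem L_comp {a b c : X} (y : a ⟶ b) (x : b ⟶ c) (z : B.fiber a) :
    B.L (y ≫ x) z = B.L x (B.L y z) := by
  have : ((B.L (y ≫ x)).toContinuousLinearEquiv : B.fiber a →L[ℂ] B.fiber c)
      = ((B.L x).toContinuousLinearEquiv : B.fiber b →L[ℂ] B.fiber c).comp
        ((B.L y).toContinuousLinearEquiv : B.fiber a →L[ℂ] B.fiber b) :=
    B.clm_ext fun z => by simp [B.L_vec, RFiber.translate_comp]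
  exact congrArg (fun T : B.fiber a →L[ℂ] B.fiber c => T z) this

variable (haar) in
/-- The section `a ↦ ∫ f(x) v_x dλ^a(x)`. -/
noncomputable def integralSection (f : C_c(Quiver.Total X, ℂ)) (a : X) : B.fiber a :=
  ∫ x : RFiber a, f x.toTotal • B.vec x ∂haar.measure a

theorem integralSection_add (f g : C_c(Quiver.Total X, ℂ)) (a : X) :
    B.integralSection haar (f + g) a = B.integralSection haar f a + B.integralSection haar g a := by
  simp only [integralSection, CompactlySupportedContinuousMap.add_apply, add_smul]
  exact integral_add (integrable_smul_of_hasCompactSupport haar (B.continuous_vec a) f)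
    (integrable_smul_of_hasCompactSupport haar (B.continuous_vec a) g)

theorem integralSection_smul (c : ℂ) (f : C_c(Quiver.Total X, ℂ)) (a : X) :
    B.integralSection haar (c • f) a = c • B.integralSection haar f a := by
  simp only [integralSection, CompactlySupportedContinuousMap.smul_apply, smul_assoc]
  exact integral_smul _ _

theorem inner_L_integralSection (f g : C_c(Quiver.Total X, ℂ)) (x : Quiver.Total X) :
    inner ℂ (B.L x.hom (B.integralSection haar f x.left)) (B.integralSection haar g x.right)
      = ∫ y : RFiber x.right, g y.toTotal * ∫ z : RFiber x.left,
        conj (f z.toTotal) * φ (y.invMul (z.translate x.hom))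
          ∂haar.measure x.left ∂haar.measure x.right := by
  have h : B.L x.hom (B.integralSection haar f x.left) = ∫ z : RFiber x.left,
      f z.toTotal • B.L x.hom (B.vec z) ∂haar.measure x.left := by
    have := (B.L x.hom).toContinuousLinearEquiv.integral_comp_comm (μ := haar.measure x.left)
      (fun z => f z.toTotal • B.vec z)
    simpa [integralSection] using this.symm
  rw [h, integralSection, inner_integral_smul haar
    (v := fun z => B.L x.hom (B.vec z)) ((B.L x.hom).continuous.comp (B.continuous_vec _)) (B.continuous_vec _) f g]
  simp only [B.L_vec, B.inner_vec]

/-- The coefficient is an iterated integral of φ(y⁻¹xz), with z in G^{s(x)} and y in G^{r(x)}. The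
parameter lemma is used first over pairs (x, y) with equal ranges, where `star f` supplies the
conjugate, and then over x. -/
theorem continuous_inner_L_integralSection [LocallyCompactSpace (Quiver.Total X)]
    (f g : C_c(Quiver.Total X, ℂ)) :
    Continuous fun x : Quiver.Total X =>
      inner ℂ (B.L x.hom (B.integralSection haar f x.left)) (B.integralSection haar g x.right) := by
  simp only [inner_L_integralSection]
  have hp : Continuous fun q : {q : Quiver.Total X × Quiver.Total X // q.2.right = q.1.right} =>
      q.1.1.left :=
    IsTopologicalGroupoid.continuous_source.comp (continuous_fst.comp continuous_subtype_val)
  have hF : Continuous fun r : {r : {q : Quiver.Total X × Quiver.Total X //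
      q.2.right = q.1.right} × Quiver.Total X // r.2.right = r.1.1.1.left} =>
        φ (leftDiv ⟨(mulOfEq ⟨(r.1.1.1.1, r.1.2), r.2⟩, r.1.1.1.2), r.1.1.2.symm⟩) := by
    refine φ.continuous.comp (continuous_leftDiv.comp (Continuous.subtype_mk ?_ _))
    refine Continuous.prodMk (continuous_mulOfEq.comp (Continuous.subtype_mk ?_ _)) ?_ <;> fun_prop
  have h1 := continuous_integral_param haar hp hF (star f)
  have h2 := continuous_integral_param haar IsTopologicalGroupoid.continuous_range h1 g
  convert h2 using 7 with x y z
  simp [leftDiv, mulOfEq, RFiber.invMul, RFiber.toTotal, RFiber.translate]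

theorem continuous_norm_integralSection [LocallyCompactSpace (Quiver.Total X)]
    (f : C_c(Quiver.Total X, ℂ)) : Continuous fun a : X => ‖B.integralSection haar f a‖ := by
  -- The squared norm is the diagonal coefficient restricted to units.
  have h := Real.continuous_sqrt.comp (Complex.continuous_re.comp
    ((B.continuous_inner_L_integralSection (haar := haar) f f).comp
      IsTopologicalGroupoid.continuous_unit))
  convert h using 2 with a
  simp only [Function.comp_def, B.L_id]
  exact norm_eq_sqrt_re_inner (𝕜 := ℂ) _

variable (haar) in
/-- The sections that are locally uniform limits of the sections `∫ f(x) v_x dλ^a(x)`. -/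
noncomputable def sections : Submodule ℂ (∀ a, B.fiber a) where
  carrier := {ξ | ∀ a, ∀ ε > (0 : ℝ), ∃ f : C_c(Quiver.Total X, ℂ),
    ∀ᶠ b in 𝓝 a, ‖ξ b - B.integralSection haar f b‖ ≤ ε}
  add_mem' := by
    intro ξ η hξ hη a ε hε
    obtain ⟨f, hf⟩ := hξ a (ε / 2) (half_pos hε)
    obtain ⟨g, hg⟩ := hη a (ε / 2) (half_pos hε)
    refine ⟨f + g, ?_⟩
    filter_upwards [hf, hg] with b hb hb'
    rw [B.integralSection_add, Pi.add_apply, add_sub_add_comm]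
    exact (norm_add_le_of_le hb hb').trans_eq (add_halves ε)
  zero_mem' := by
    intro a ε hε
    refine ⟨0, .of_forall fun b => ?_⟩
    simpa [integralSection] using hε.le
  smul_mem' := by
    intro c ξ hξ a ε hε
    obtain ⟨f, hf⟩ := hξ a (ε / (‖c‖ + 1)) (by positivity)
    refine ⟨c • f, ?_⟩
    filter_upwards [hf] with b hb
    rw [B.integralSection_smul, Pi.smul_apply, ← smul_sub, norm_smul]
    calc _ ≤ (‖c‖ + 1) * (ε / (‖c‖ + 1)) := by gcongr; linarith
      _ = ε := by field_simp

theorem integralSection_mem_sections (f : C_c(Quiver.Total X, ℂ)) :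
    B.integralSection haar f ∈ B.sections haar := fun a ε hε =>
  ⟨f, .of_forall fun b => by simpa using hε.le⟩

/-- Each v_x is a limit of averages of v over normalized bumps at x, and the v_x span a dense
subspace. -/
theorem dense_eval_sections [LocallyCompactSpace (Quiver.Total X)] (a : X) :
    Dense {z : B.fiber a | ∃ ξ ∈ B.sections haar, ξ a = z} := by
  let S : Submodule ℂ (B.fiber a) := (B.sections haar).map (LinearMap.proj a)
  have hS : {z : B.fiber a | ∃ ξ ∈ B.sections haar, ξ a = z} = S := by
    ext z
    simp [S]
  rw [hS, ← dense_closure]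
  refine (B.dense_span a).mono ?_
  have : Submodule.span ℂ (Set.range (B.vec (a := a))) ≤ S.topologicalClosure := by
    rw [Submodule.span_le]
    rintro _ ⟨x, rfl⟩
    refine Metric.mem_closure_iff.mpr fun ε hε => ?_
    have hU := (B.continuous_vec a).continuousAt (x := x) (Metric.closedBall_mem_nhds _ (half_pos hε))
    rw [(RFiber.isEmbedding_toTotal a).nhds_eq_comap] at hU
    obtain ⟨W, hW, hWU⟩ := hU
    obtain ⟨f, hf, hfW, hf1⟩ := exists_normalized_bump haar x hW
    refine ⟨B.integralSection haar f a, ⟨_, B.integralSection_mem_sections f, rfl⟩, ?_⟩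
    have h := norm_integral_smul_sub_le haar (B.continuous_vec a) hf (B.vec x) (ε := ε / 2)
      fun y hy => by
        have : B.vec y ∈ Metric.closedBall (B.vec x) (ε / 2) := hWU (hfW _ hy)
        rwa [mem_closedBall_iff_norm] at this
    rw [hf1, Complex.ofReal_one, one_smul, one_mul] at h
    rw [dist_comm, dist_eq_norm]
    exact h.trans_lt (half_lt_self hε)
  exact this

theorem continuous_norm_of_mem_sections [LocallyCompactSpace (Quiver.Total X)]
    {ξ : ∀ a, B.fiber a} (hξ : ξ ∈ B.sections haar) : Continuous fun a => ‖ξ a‖ := by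
  refine continuous_of_forall_exists_dist_le fun a ε hε => ?_
  obtain ⟨f, hf⟩ := hξ a ε hε
  refine ⟨_, B.continuous_norm_integralSection (haar := haar) f, ?_⟩
  filter_upwards [hf] with b hb
  exact (dist_norm_norm_le _ _).trans hb

theorem mem_sections_of_locally_approx {ξ : ∀ a, B.fiber a} (h : ∀ a, ∀ ε > (0 : ℝ),
    ∃ η ∈ B.sections haar, ∀ᶠ b in 𝓝 a, ‖ξ b - η b‖ ≤ ε) : ξ ∈ B.sections haar := by
  intro a ε hε
  obtain ⟨η, hη, h1⟩ := h a (ε / 2) (half_pos hε)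
  obtain ⟨f, hf⟩ := hη a (ε / 2) (half_pos hε)
  refine ⟨f, ?_⟩
  filter_upwards [h1, hf] with b hb hb'
  rw [← sub_add_sub_cancel _ (η b)]
  exact (norm_add_le_of_le hb hb').trans_eq (add_halves ε)

theorem continuous_inner_L_of_mem_sections [LocallyCompactSpace (Quiver.Total X)]
    {ξ η : ∀ a, B.fiber a} (hξ : ξ ∈ B.sections haar) (hη : η ∈ B.sections haar) {C D : ℝ}
    (hC : ∀ a, ‖ξ a‖ ≤ C) (hD : ∀ a, ‖η a‖ ≤ D) :
    Continuous fun x : Quiver.Total X => inner ℂ (B.L x.hom (ξ x.left)) (η x.right) := by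
  refine continuous_of_forall_exists_dist_le fun x ε hε => ?_
  have hC0 : 0 ≤ C := (norm_nonneg _).trans (hC x.left)
  have hD0 : 0 ≤ D := (norm_nonneg _).trans (hD x.left)
  -- The bound 1 gives ‖z'‖ ≤ C + 1, so the total error is at most δ D + (C + 1) δ = δ (C + D + 1) ≤
  -- ε.
  set δ := min 1 (ε / (C + D + 1)) with hδ
  have hδ0 : 0 < δ := by positivity
  obtain ⟨f, hf⟩ := hξ x.left δ hδ0
  obtain ⟨g, hg⟩ := hη x.right δ hδ0
  refine ⟨_, B.continuous_inner_L_integralSection (haar := haar) f g, ?_⟩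
  filter_upwards [IsTopologicalGroupoid.continuous_source.continuousAt.eventually hf,
    IsTopologicalGroupoid.continuous_range.continuousAt.eventually hg] with y hy hy'
  set z := ξ y.left
  set z' := B.integralSection haar f y.left
  set t := η y.right
  set t' := B.integralSection haar g y.right
  have hz' : ‖z'‖ ≤ C + 1 := by
    have h1 : ‖z'‖ ≤ ‖z‖ + ‖z - z'‖ := norm_le_norm_add_norm_sub' z' z |>.trans_eq (by
      rw [norm_sub_rev])
    linarith [hC y.left, min_le_left 1 (ε / (C + D + 1))]
  have h : inner ℂ (B.L y.hom z) t - inner ℂ (B.L y.hom z') t'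
      = inner ℂ (B.L y.hom (z - z')) t + inner ℂ (B.L y.hom z') (t - t') := by
    rw [map_sub, inner_sub_left, inner_sub_right]
    ring
  rw [dist_eq_norm, h]
  calc _ ≤ ‖B.L y.hom (z - z')‖ * ‖t‖ + ‖B.L y.hom z'‖ * ‖t - t'‖ :=
        norm_add_le_of_le (norm_inner_le_norm _ _) (norm_inner_le_norm _ _)
    _ ≤ δ * D + (C + 1) * δ := by
        rw [LinearIsometryEquiv.norm_map, LinearIsometryEquiv.norm_map]
        gcongr
        exact hD _
    _ = δ * (C + D + 1) := by ring
    _ ≤ ε / (C + D + 1) * (C + D + 1) := by gcongr; exact min_le_right _ _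
    _ = ε := by field_simp

variable (haar) in
/-- The topologized bundle. -/
noncomputable def toGHilbertBundle [LocallyCompactSpace (Quiver.Total X)] :
    GHilbertBundle.{u, v, w} X where
  fiber := B.fiber
  sections := B.sections haar
  dense_eval := B.dense_eval_sections
  continuous_norm _ hξ := B.continuous_norm_of_mem_sections hξ
  mem_of_locally_approx _ h := B.mem_sections_of_locally_approx h
  L := B.L
  L_id := B.L_id
  L_comp := B.L_comp
  continuous_coefficient := by
    rintro ξ ⟨hξ, C, hC⟩ η ⟨hη, D, hD⟩
    exact B.continuous_inner_L_of_mem_sections hξ hη hC hD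

/-- The section of the vectors indexed by the units. -/
def unitSection (a : X) : B.fiber a := B.vec ⟨𝟙 a⟩

theorem inner_L_unitSection (x : Quiver.Total X) :
    inner ℂ (B.L x.hom (B.unitSection x.left)) (B.unitSection x.right) = φ x := by
  simp [unitSection, B.L_vec, B.inner_vec, RFiber.translate, RFiber.invMul, Groupoid.inv_eq_inv]

theorem norm_sq_vec {a : X} (x : RFiber a) :
    ‖B.vec x‖ ^ 2 = (φ ⟨x.source, x.source, 𝟙 x.source⟩).re := by
  rw [← inner_self_eq_norm_sq (𝕜 := ℂ), B.inner_vec]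
  simp [RFiber.invMul]

/-- A crude replacement for the bound by the square root of ‖φ‖. -/
theorem norm_unitSection_le (a : X) : ‖B.unitSection a‖ ≤ ‖φ‖ + 1 := by
  have h : ‖B.unitSection a‖ ^ 2 ≤ ‖φ‖ := by
    rw [unitSection, norm_sq_vec]
    exact (Complex.re_le_norm _).trans (φ.norm_coe_le_norm _)
  nlinarith [norm_nonneg (B.unitSection a), norm_nonneg φ]

theorem norm_sq_vec_sub_unitSection {a : X} (x : RFiber a) :
    ‖B.vec x - B.unitSection a‖ ^ 2 = (φ ⟨x.source, x.source, 𝟙 x.source⟩).re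
      - 2 * (φ x.toTotal).re + (φ ⟨a, a, 𝟙 a⟩).re := by
  rw [norm_sub_sq (𝕜 := ℂ), norm_sq_vec, unitSection, norm_sq_vec, B.inner_vec]
  simp [RFiber.invMul, RFiber.toTotal, Groupoid.inv_eq_inv]

/-- One bump f at the unit a serves all nearby b: on its support v_x is within ε / 2 of ξ(r(x)),
whatever the range of x. -/
theorem unitSection_mem_sections [LocallyCompactSpace (Quiver.Total X)] :
    B.unitSection ∈ B.sections haar := by
  intro a ε hε
  have hc : Continuous fun x : Quiver.Total X => (φ ⟨x.left, x.left, 𝟙 x.left⟩).re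
      - 2 * (φ x).re + (φ ⟨x.right, x.right, 𝟙 x.right⟩).re := by
    have h1 := φ.continuous.comp (IsTopologicalGroupoid.continuous_unit.comp
      (IsTopologicalGroupoid.continuous_source (X := X)))
    have h2 := φ.continuous.comp (IsTopologicalGroupoid.continuous_unit.comp
      (IsTopologicalGroupoid.continuous_range (X := X)))
    exact ((Complex.continuous_re.comp h1).sub
      (continuous_const.mul (Complex.continuous_re.comp φ.continuous))).add
      (Complex.continuous_re.comp h2)
  have hU := (hc.tendsto (⟨𝟙 a⟩ : RFiber a).toTotal).eventually_le_const (u := (ε / 2) ^ 2) (by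
    simp only [RFiber.toTotal]
    nlinarith)
  obtain ⟨f, hf, hfU, hf1⟩ := exists_normalized_bump haar ⟨𝟙 a⟩ hU
  have hN := continuous_integral_norm haar f
  refine ⟨f, ?_⟩
  -- The mass of f is 1 only on G^a. On G^b it is some N, which adds the error |1 - N| ‖ξ(b)‖ to N ε
  -- / 2; at b = a this bound equals ε / 2.
  have hlim : Continuous fun b : X =>
      |1 - ∫ x : RFiber b, ‖f x.toTotal‖ ∂haar.measure b| * (‖φ‖ + 1)
        + (∫ x : RFiber b, ‖f x.toTotal‖ ∂haar.measure b) * (ε / 2) := by fun_prop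
  have hev := (hlim.tendsto a).eventually_le_const (u := ε) (by
    rw [hf1]
    simpa using hε)
  filter_upwards [hev] with b hb
  have h := norm_integral_smul_sub_le haar (B.continuous_vec b) hf (B.unitSection b) (ε := ε / 2)
    fun x hx => by
      refine le_of_sq_le_sq ?_ (half_pos hε).le
      rw [norm_sq_vec_sub_unitSection]
      exact hfU _ hx
  set N : ℝ := ∫ x : RFiber b, ‖f x.toTotal‖ ∂haar.measure b
  refine le_trans ?_ hb
  rw [← sub_add_sub_cancel _ ((N : ℂ) • B.unitSection b)]
  refine norm_add_le_of_le ?_ (by rw [norm_sub_rev]; exact h)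
  have h1 : B.unitSection b - (N : ℂ) • B.unitSection b = ((1 - N : ℝ) : ℂ) • B.unitSection b := by
    push_cast
    rw [sub_smul, one_smul]
  rw [h1, norm_smul, Complex.norm_real, Real.norm_eq_abs]
  gcongr
  exact B.norm_unitSection_le b

end FeatureBundle

end PatersonGroupoid

/-! ### The equivalence -/

theorem mainTheorem5 {X : Type u} [Groupoid.{v} X] [TopologicalSpace X]
    [TopologicalSpace (Quiver.Total X)] [PatersonGroupoid.IsTopologicalGroupoid X]
    [LocallyCompactSpace (Quiver.Total X)] [T2Space (Quiver.Total X)]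
    [SecondCountableTopology (Quiver.Total X)]
    (haar : PatersonGroupoid.LeftHaarSystem X) (φ : Quiver.Total X →ᵇ ℂ) :
    PatersonGroupoid.IsPositiveDefinite haar φ ↔
      ∃ H : PatersonGroupoid.GHilbertBundle.{u, v, w} X,
        ∃ ξ ∈ H.boundedSections, ∀ x : Quiver.Total X, φ x = H.coefficient ξ ξ x := by
  constructor
  · intro hφ
    obtain ⟨B⟩ := hφ.nonempty_featureBundle
    exact ⟨B.toGHilbertBundle haar, B.unitSection,
      ⟨B.unitSection_mem_sections, _, B.norm_unitSection_le⟩,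
      fun x => (B.inner_L_unitSection x).symm⟩
  · rintro ⟨H, ξ, -, h⟩
    exact PatersonGroupoid.isPositiveDefinite_of_eq_coefficient haar H ξ h
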